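/- Let $\mathbf{Ab}$ be the category of abelian groups, let $S^1=\{z\in\mathbb{C} : |z|=1\}$ be the circle group, and for an abelian group $A$ let $\mathbf{Ab}(A,S^1)$ be the abelian group of all group homomorphisms $A\to S^1$ with pointwise structure. The functor $\mathbf{Ab}(-,S^1)\colon \mathbf{Ab}\to\mathbf{Ab}^{\mathrm{op}}$ is left adjoint to $\mathbf{Ab}(-,S^1)\colon \mathbf{Ab}^{\mathrm{op}}\to\mathbf{Ab}$ via the natural bijection $\mathbf{Ab}(B,\mathbf{Ab}(A,S^1))\cong\mathbf{Ab}(A,\mathbf{Ab}(B,S^1))$ interchanging arguments. The monad on $\mathbf{Ab}$ induced by this adjunction, $A\mapsto \mathbf{Ab}(\mathbf{Ab}(A,S^1),S^1)$, is called the double dualization monad. Let $\{S^1\times S^1\}$ be the one-object full subcategory, on the torus $S^1\times S^1$, of the category of compact Hausdorff abelian groups and continuous group homomorphisms, and let $U\colon\{S^1\times S^1\}\to\mathbf{Ab}$ be the functor that forgets the topology. For a functor $F\colon\mathcal{A}\to\mathcal{C}$ whose right Kan extension $\operatorname{Ran}_F F$ along itself exists, with counit $\varphi\colon(\operatorname{Ran}_F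 F)F\to F$, the codensity monad of $F$ is the monad $(\operatorname{Ran}_F F,\eta,\mu)$ whose unit $\eta$ and multiplication $\mu$ are the natural transformations corresponding, under the universal property of $\operatorname{Ran}_F F$, to $\mathrm{id}_F\colon F\to F$ and to $\varphi\circ(\operatorname{Ran}_F F)\varphi\colon(\operatorname{Ran}_F F)(\operatorname{Ran}_F F)F\to F$, respectively. Theorem. The right Kan extension of $U$ along itself exists and is pointwise, i.e. $(\operatorname{Ran}_U U)X=\lim_{f\colon X\to UT}UT$ for every abelian group $X$, where $T=S^1\times S^1$; and the codensity monad of $U$ is isomorphic, as a monad, to the double dualization monad on $\mathbf{Ab}$ with respect to $S^1$. -/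

import Mathlib

open CategoryTheory

universe v₁ v₂ u₁ u₂ u

noncomputable section

namespace Codensity

/-! ### The codensity monad of a functor -/

section CodensityMonad

variable {A : Type u₁} [Category.{v₁} A] {C : Type u₂} [Category.{v₂} C]
variable (F : A ⥤ C) [F.HasRightKanExtension F]

/-- The right Kan extension `Ran_F F` of `F` along itself. -/
abbrev ran : C ⥤ C := F.rightKanExtension F

/-- The counit `φ : (Ran_F F) F ⟶ F`. -/
abbrev ranCounit : F ⋙ ran F ⟶ F := F.rightKanExtensionCounit F

/-- The unit `Id ⟶ Ran_F F`, corresponding to `id : F ⟶ F`. -/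
def codensityUnit : 𝟭 C ⟶ ran F :=
  (ran F).liftOfIsRightKanExtension (ranCounit F) (𝟭 C) (Functor.rightUnitor F).hom

/-- The multiplication `(Ran_F F) (Ran_F F) ⟶ Ran_F F`, corresponding to
`(Ran_F F) (Ran_F F) F ⟶ (Ran_F F) F ⟶ F`, i.e. to `φ ∘ (Ran_F F) φ`. -/
def codensityMul : ran F ⋙ ran F ⟶ ran F :=
  (ran F).liftOfIsRightKanExtension (ranCounit F) (ran F ⋙ ran F)
    ((Functor.associator F (ran F) (ran F)).inv ≫
      Functor.whiskerRight (ranCounit F) (ran F) ≫ ranCounit F)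

theorem codensityUnit_fac (X : A) :
    (codensityUnit F).app (F.obj X) ≫ (ranCounit F).app X = 𝟙 (F.obj X) := by
  simp [codensityUnit]

theorem codensityMul_fac (X : A) :
    (codensityMul F).app (F.obj X) ≫ (ranCounit F).app X =
      (ran F).map ((ranCounit F).app X) ≫ (ranCounit F).app X := by
  simp [codensityMul]

theorem codensity_left_unit :
    Functor.whiskerLeft (ran F) (codensityUnit F) ≫ codensityMul F =
      (Functor.rightUnitor (ran F)).hom := by
  apply (ran F).hom_ext_of_isRightKanExtension (ranCounit F)
  ext X
  have h := (codensityUnit F).naturality ((ranCounit F).app X)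
  have h1 := codensityUnit_fac F X
  have h2 := codensityMul_fac F X
  simp only [Functor.id_obj, Functor.id_map, Functor.comp_obj] at h h1 h2
  simp only [NatTrans.comp_app, Functor.whiskerLeft_app, Functor.rightUnitor_hom_app,
    Category.assoc, Functor.comp_obj, Functor.id_obj, Category.id_comp]
  rw [h2, ← Category.assoc, ← h, Category.assoc, h1, Category.comp_id]

theorem codensity_right_unit :
    Functor.whiskerRight (codensityUnit F) (ran F) ≫ codensityMul F =
      (Functor.leftUnitor (ran F)).hom := by
  apply (ran F).hom_ext_of_isRightKanExtension (ranCounit F)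
  ext X
  have h1 := codensityUnit_fac F X
  have h2 := codensityMul_fac F X
  simp only [Functor.id_obj, Functor.comp_obj] at h1 h2
  simp only [NatTrans.comp_app, Functor.whiskerLeft_app, Functor.whiskerRight_app,
    Functor.leftUnitor_hom_app, Category.assoc, Functor.comp_obj, Functor.id_obj,
    Category.id_comp]
  rw [h2, ← Category.assoc, ← Functor.map_comp, h1, CategoryTheory.Functor.map_id, Category.id_comp]

theorem codensity_assoc :
    Functor.whiskerRight (codensityMul F) (ran F) ≫ codensityMul F =
      (Functor.associator (ran F) (ran F) (ran F)).hom ≫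
        Functor.whiskerLeft (ran F) (codensityMul F) ≫ codensityMul F := by
  apply (ran F).hom_ext_of_isRightKanExtension (ranCounit F)
  ext X
  have h := (codensityMul F).naturality ((ranCounit F).app X)
  have h2 := codensityMul_fac F X
  simp only [Functor.comp_obj, Functor.comp_map] at h h2
  simp only [NatTrans.comp_app, Functor.whiskerLeft_app, Functor.whiskerRight_app,
    Functor.associator_hom_app, Category.assoc, Functor.comp_obj, Category.id_comp]
  rw [h2, ← Category.assoc, ← Functor.map_comp, h2, Functor.map_comp, Category.assoc]
  rw [← Category.assoc ((codensityMul F).app _), ← h, Category.assoc, h2]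

/-- The codensity monad `(Ran_F F, η, μ)` of a functor `F` whose right Kan extension along
itself exists. -/
def codensityMonad : Monad C where
  toFunctor := ran F
  η := codensityUnit F
  μ := codensityMul F
  assoc X := by simpa using NatTrans.congr_app (codensity_assoc F) X
  left_unit X := by simpa using NatTrans.congr_app (codensity_left_unit F) X
  right_unit X := by simpa using NatTrans.congr_app (codensity_right_unit F) X

end CodensityMonad

/-! ### The double dualization monad on abelian groups -/

/-- The functor `Ab(-, S¹) : Abᵒᵖ ⥤ Ab`: all group homomorphisms into the circle group, with
the pointwise group structure, acting on morphisms by precomposition. -/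
def dual : CommGrpCat.{u}ᵒᵖ ⥤ CommGrpCat.{u} where
  obj B := CommGrpCat.of (B.unop →* Circle)
  map f := CommGrpCat.ofHom (MonoidHom.compHom' f.unop.hom)

/-- The bijection `Ab(B, Ab(A, S¹)) ≃ Ab(A, Ab(B, S¹))` interchanging the two arguments. -/
def dualHomEquiv (A : CommGrpCat.{u}) (B : CommGrpCat.{u}ᵒᵖ) :
    (dual.rightOp.obj A ⟶ B) ≃ (A ⟶ dual.obj B) where
  toFun f := CommGrpCat.ofHom (MonoidHom.flip (M := B.unop) (N := A) (P := Circle) f.unop.hom)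
  invFun g :=
    (CommGrpCat.ofHom (MonoidHom.flip (M := A) (N := B.unop) (P := Circle) g.hom)).op
  left_inv _ := rfl
  right_inv _ := rfl

/-- The dual adjunction `Ab(-, S¹) ⊣ Ab(-, S¹) : Abᵒᵖ ⥤ Ab`. -/
def dualAdjunction : dual.{u}.rightOp ⊣ dual.{u} :=
  Adjunction.mkOfHomEquiv
    { homEquiv := dualHomEquiv
      homEquiv_naturality_left_symm := fun _ _ => rfl
      homEquiv_naturality_right := fun _ _ => rfl }

/-- The double dualization monad `A ↦ Ab(Ab(A, S¹), S¹)`, induced by the dual adjunction. -/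
def doubleDualizationMonad : Monad CommGrpCat.{u} := dualAdjunction.toMonad

/-! ### The torus as a one-object category and its forgetful functor -/

/-- Compact Hausdorff abelian groups. -/
structure CHAb : Type (u + 1) where
  carrier : Type u
  [commGroup : CommGroup carrier]
  [topologicalSpace : TopologicalSpace carrier]
  [isTopologicalGroup : IsTopologicalGroup carrier]
  [compactSpace : CompactSpace carrier]
  [t2Space : T2Space carrier]

attribute [instance] CHAb.commGroup CHAb.topologicalSpace CHAb.isTopologicalGroup
  CHAb.compactSpace CHAb.t2Space

/-- Morphisms of `CHAb` are the continuous group homomorphisms. -/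
instance : Category CHAb.{u} where
  Hom G H := G.carrier →ₜ* H.carrier
  id G := ContinuousMonoidHom.id G.carrier
  comp f g := ContinuousMonoidHom.comp g f

/-- The functor from compact Hausdorff abelian groups to abelian groups forgetting the
topology. -/
def CHAb.forgetToAb : CHAb.{u} ⥤ CommGrpCat.{u} where
  obj G := CommGrpCat.of G.carrier
  map f := CommGrpCat.ofHom (ContinuousMonoidHom.toMonoidHom f)

instance : IsTopologicalGroup (ULift.{u} (Circle × Circle)) where
  continuous_mul := continuous_uliftUp.comp
    ((continuous_uliftDown.comp continuous_fst).mul (continuous_uliftDown.comp continuous_snd))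
  continuous_inv := continuous_uliftUp.comp continuous_uliftDown.inv

/-- The torus `S¹ × S¹` with its product topology (moved to the universe `u`). -/
def torus : CHAb.{u} where
  carrier := ULift.{u} (Circle × Circle)

/-- The one-object full subcategory `{S¹ × S¹}` of `CHAb`. -/
abbrev TorusCat : Type := InducedCategory CHAb.{u} (fun _ : Unit => torus.{u})

/-- The forgetful functor `U : {S¹ × S¹} ⥤ Ab`: the inclusion into `CHAb` followed by the
functor forgetting the topology. -/
def torusForget : TorusCat.{u} ⥤ CommGrpCat.{u} :=
  inducedFunctor (fun _ : Unit => torus.{u}) ⋙ CHAb.forgetToAb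

end Codensity

end

noncomputable section

namespace Codensity

/-! ### Continuous characters of the circle and of the torus -/

/-! A cone over the maps `X → T`, with vertex `P`, is a family of maps `P → T` compatible with the
continuous endomorphisms of the torus `T`. Two characters of `X` pair into one map `X → T`, and
endomorphisms such as `(z, w) ↦ (zw, 1)` then force the legs to respect products. So a cone amounts
to a homomorphism `(X →* Circle) →* (P →* Circle)`, and flipping its arguments gives a map from `P`
to the double dual of `X`. Conversely, the double dual carries such a cone because continuous
characters of `T` are Laurent monomials (`exists_eq_zpow_mul_zpow`), which every homomorphism
respects. The monad structures agree by `isoCodensityMonad`, since evaluation at the two coordinates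
is compatible with unit and multiplication. -/

/-- A continuous additive character of `AddCircle T` is a Fourier monomial. -/
theorem exists_eq_fourier {T : ℝ} [Fact (0 < T)] (f : C(AddCircle T, ℂ)) (h₀ : f 0 = 1)
    (hadd : ∀ x y, f (x + y) = f x * f y) : ∃ n : ℤ, f = fourier n := by
  by_cases h : ∃ n, fourierCoeff f n ≠ 0
  · obtain ⟨n, hn⟩ := h
    refine ⟨n, ContinuousMap.ext fun y => ?_⟩
    -- Translation invariance of Haar measure: shifting the variable by `y` pulls out the factor
    -- `fourier (-n) y * f y`.
    have key : fourierCoeff f n = fourier (-n) y * f y * fourierCoeff f n := by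
      rw [fourierCoeff, ← MeasureTheory.integral_const_mul,
        ← MeasureTheory.integral_add_left_eq_self _ y]
      congr 1
      ext x
      simp only [hadd, smul_eq_mul, fourier_apply, smul_add, AddCircle.toCircle_add,
        Circle.coe_mul]
      ring
    have h₁ : fourier (-n) y * f y = 1 := mul_right_cancel₀ hn (by rw [← key, one_mul])
    calc f y = (fourier n y * fourier (-n) y) * f y := by
          rw [← fourier_add, add_neg_cancel, fourier_zero, one_mul]
      _ = fourier n y := by rw [mul_assoc, h₁, mul_one]
  · push Not at h
    -- If all coefficients vanish, the Fourier series converges trivially, so `f 0 = 0`, against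
    -- `h₀`.
    have hs := has_pointwise_sum_fourier_series_of_summable (f := f)
      (summable_zero.congr fun n => (h n).symm) 0
    simp only [h, zero_smul, h₀] at hs
    exact absurd (hs.unique hasSum_zero) one_ne_zero

/-- A continuous endomorphism of the circle group is a power map. -/
theorem exists_eq_zpow (χ : Circle →* Circle) (hχ : Continuous χ) :
    ∃ n : ℤ, ∀ z, χ z = z ^ n := by
  have : Fact ((0 : ℝ) < 1) := ⟨one_pos⟩
  obtain ⟨n, hn⟩ := exists_eq_fourier (T := 1)
    ⟨fun x => (χ (AddCircle.toCircle x) : ℂ),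
      continuous_subtype_val.comp (hχ.comp AddCircle.continuous_toCircle)⟩
    (by simp) (by simp [AddCircle.toCircle_add])
  refine ⟨n, fun z => ?_⟩
  obtain ⟨x, rfl⟩ := (AddCircle.homeomorphCircle (one_ne_zero' ℝ)).surjective z
  rw [AddCircle.homeomorphCircle_apply]
  have := DFunLike.congr_fun hn x
  rw [fourier_apply, AddCircle.toCircle_zsmul] at this
  exact Circle.ext this

/-- A continuous character of the torus is a Laurent monomial in the two coordinates. -/
theorem exists_eq_zpow_mul_zpow (p : ULift.{u} (Circle × Circle) →* Circle) (hp : Continuous p) :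
    ∃ a b : ℤ, ∀ z w, p ⟨(z, w)⟩ = z ^ a * w ^ b := by
  let up : Circle × Circle →* ULift.{u} (Circle × Circle) := MulEquiv.ulift.symm.toMonoidHom
  have hup : Continuous up := continuous_uliftUp
  obtain ⟨a, ha⟩ := exists_eq_zpow ((p.comp up).comp (MonoidHom.inl _ _))
    ((hp.comp hup).comp (by fun_prop : Continuous fun z : Circle => (z, (1 : Circle))))
  obtain ⟨b, hb⟩ := exists_eq_zpow ((p.comp up).comp (MonoidHom.inr _ _))
    ((hp.comp hup).comp (by fun_prop : Continuous fun w : Circle => ((1 : Circle), w)))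
  refine ⟨a, b, fun z w => ?_⟩
  rw [← ha, ← hb]
  simp only [MonoidHom.comp_apply, ← map_mul]
  simp [up]
  rfl

/-! ### The cone structure on the double dual -/

/-- The first coordinate character of the torus. -/
def torusFst : ULift.{u} (Circle × Circle) →* Circle :=
  (MonoidHom.fst _ _).comp MulEquiv.ulift.toMonoidHom

/-- The second coordinate character of the torus. -/
def torusSnd : ULift.{u} (Circle × Circle) →* Circle :=
  (MonoidHom.snd _ _).comp MulEquiv.ulift.toMonoidHom

/-- The homomorphism into the torus with the given coordinates. -/
def torusPair {X : Type*} [CommGroup X] (χ ψ : X →* Circle) :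
    X →* ULift.{u} (Circle × Circle) :=
  MulEquiv.ulift.symm.toMonoidHom.comp (χ.prod ψ)

/-- Elements of the double dual commute with continuous characters of the torus. -/
theorem doubleDual_apply_comp {X : Type*} [CommGroup X] (ξ : (X →* Circle) →* Circle)
    (f : X →* ULift.{u} (Circle × Circle)) (p : ULift.{u} (Circle × Circle) →* Circle)
    (hp : Continuous p) :
    ξ (p.comp f) = p ⟨(ξ (torusFst.comp f), ξ (torusSnd.comp f))⟩ := by
  obtain ⟨a, b, h⟩ := exists_eq_zpow_mul_zpow p hp
  -- The monomial form lets `ξ`, a mere homomorphism, pass through `p`.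
  rw [h, ← map_zpow, ← map_zpow, ← map_mul]
  congr 1
  ext x : 1
  exact h _ _

theorem continuous_torusFst : Continuous torusFst.{u} :=
  continuous_fst.comp continuous_uliftDown

theorem continuous_torusSnd : Continuous torusSnd.{u} :=
  continuous_snd.comp continuous_uliftDown

/-- Evaluation of an element of the double dual of the torus at the two coordinates. -/
def torusEval : ((ULift.{u} (Circle × Circle) →* Circle) →* Circle) →*
    ULift.{u} (Circle × Circle) :=
  torusPair (MonoidHom.eval torusFst) (MonoidHom.eval torusSnd)

/-- The evaluation maps exhibiting the double dualization functor as a right extension of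
`torusForget` along itself. -/
def doubleDualCounit :
    torusForget.{u} ⋙ doubleDualizationMonad.{u}.toFunctor ⟶ torusForget.{u} where
  app _ := CommGrpCat.ofHom torusEval
  naturality T T' g := by
    apply CommGrpCat.hom_ext
    ext ξ : 1
    let g' : torus.carrier →ₜ* torus.carrier := g.hom
    exact ULift.ext _ _ (Prod.ext
      (doubleDual_apply_comp ξ (MonoidHom.id _) (torusFst.comp g'.toMonoidHom)
        (continuous_torusFst.comp g'.continuous_toFun))
      (doubleDual_apply_comp ξ (MonoidHom.id _) (torusSnd.comp g'.toMonoidHom)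
        (continuous_torusSnd.comp g'.continuous_toFun)))

/-- The double dualization functor as a right extension of `torusForget` along itself. -/
def doubleDualExtension : torusForget.{u}.RightExtension torusForget.{u} :=
  Functor.RightExtension.mk doubleDualizationMonad.{u}.toFunctor doubleDualCounit

/-! ### Universality of the double dual -/

/-- A homomorphism into the torus, as an object of the category indexing the cones. -/
def torusArrow {X : CommGrpCat.{u}} (f : X →* ULift.{u} (Circle × Circle)) :
    StructuredArrow X torusForget.{u} :=
  let T : TorusCat.{u} := ()
  StructuredArrow.mk (S := X) (T := torusForget.{u}) (Y := T)
    (show X ⟶ torusForget.{u}.obj T from CommGrpCat.ofHom f)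

/-- A continuous endomorphism of the torus, as a morphism between cone indices. -/
def torusArrowHom {X : CommGrpCat.{u}} (f : X →* ULift.{u} (Circle × Circle))
    (g : ULift.{u} (Circle × Circle) →ₜ* ULift.{u} (Circle × Circle)) :
    torusArrow f ⟶ torusArrow (g.toMonoidHom.comp f) :=
  StructuredArrow.homMk (InducedCategory.homMk g) rfl

section Lift

variable {X : CommGrpCat.{u}} (s : Limits.Cone (StructuredArrow.proj X torusForget ⋙ torusForget))

/-- The leg of a cone at a homomorphism into the torus. -/
def leg (f : X →* ULift.{u} (Circle × Circle)) : s.pt →* ULift.{u} (Circle × Circle) :=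
  (s.π.app (torusArrow f)).hom

theorem leg_comp (f : X →* ULift.{u} (Circle × Circle))
    (g : ULift.{u} (Circle × Circle) →ₜ* ULift.{u} (Circle × Circle)) :
    leg s (g.toMonoidHom.comp f) = g.toMonoidHom.comp (leg s f) := by
  exact congrArg CommGrpCat.Hom.hom (s.w (torusArrowHom f g)).symm

/-- The continuous endomorphism of the torus with the given coordinates. -/
def torusEnd (p q : ULift.{u} (Circle × Circle) →* Circle) (hp : Continuous p)
    (hq : Continuous q) : ULift.{u} (Circle × Circle) →ₜ* ULift.{u} (Circle × Circle) where
  toMonoidHom := torusPair p q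
  continuous_toFun := continuous_uliftUp.comp (hp.prodMk hq)

/-- The coordinates of the legs of a cone, as a homomorphism between dual groups. -/
def legHom : (X →* Circle) →* (s.pt →* Circle) where
  toFun χ := torusFst.comp (leg s (torusPair χ 1))
  map_one' := by
    have h := leg_comp s (torusPair 1 1) (torusEnd 1 1 continuous_one continuous_one)
    exact congrArg torusFst.comp h
  map_mul' χ ψ := by
    -- The legs at `χψ`, `χ` and `ψ`, each padded by `1`, are all images of the single leg at the
    -- pair `(χ, ψ)`.
    have h := leg_comp s (torusPair χ ψ) (torusEnd (torusFst * torusSnd) 1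
      (continuous_torusFst.mul continuous_torusSnd) continuous_one)
    have h₁ := leg_comp s (torusPair χ ψ) (torusEnd torusFst 1 continuous_torusFst continuous_one)
    have h₂ := leg_comp s (torusPair χ ψ) (torusEnd torusSnd 1 continuous_torusSnd continuous_one)
    have e := congrArg torusFst.comp h
    have e₁ := congrArg torusFst.comp h₁
    have e₂ := congrArg torusFst.comp h₂
    exact e.trans (congrArg₂ (· * ·) e₁ e₂).symm

/-- The endomorphism `(z, w) ↦ (z, 1)` carries `f` to the padded index at which `legHom` is defined.
With `legHom_snd`, this recovers every leg of the cone from `legHom`. -/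
theorem legHom_fst (f : X →* ULift.{u} (Circle × Circle)) :
    legHom s (torusFst.comp f) = torusFst.comp (leg s f) := by
  have h := leg_comp s f (torusEnd torusFst 1 continuous_torusFst continuous_one)
  have e := congrArg torusFst.comp h
  exact e

theorem legHom_snd (f : X →* ULift.{u} (Circle × Circle)) :
    legHom s (torusSnd.comp f) = torusSnd.comp (leg s f) := by
  have h := leg_comp s f (torusEnd torusSnd 1 continuous_torusSnd continuous_one)
  have e := congrArg torusFst.comp h
  exact e

end Lift

/-- The double dualization functor is a pointwise right Kan extension of `torusForget` along
itself. -/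
def doubleDualExtensionIsPointwise :
    doubleDualExtension.{u}.IsPointwiseRightKanExtension := fun X =>
  { lift := fun s => CommGrpCat.ofHom (legHom s).flip
    fac := fun s j => by
      apply CommGrpCat.hom_ext
      ext w : 1
      let f : X →* ULift.{u} (Circle × Circle) := j.hom.hom
      exact ULift.ext _ _ (Prod.ext (DFunLike.congr_fun (legHom_fst s f) w)
        (DFunLike.congr_fun (legHom_snd s f) w))
    uniq := fun s m hm => by
      apply CommGrpCat.hom_ext
      ext w : 1
      refine MonoidHom.ext fun χ => ?_
      -- The legs at the padded characters already determine all values of `m`.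
      have h := hm (torusArrow (torusPair χ 1))
      exact congrArg torusFst (DFunLike.congr_fun (congrArg CommGrpCat.Hom.hom h) w) }

/-! ### Recognition of codensity monads -/

section Recognition

variable {A : Type u₁} [Category.{v₁} A] {C : Type u₂} [Category.{v₂} C]
variable (F : A ⥤ C) [F.HasRightKanExtension F]

/-- A monad whose underlying functor is a right Kan extension of `F` along itself, with counit
compatible with the unit and the multiplication, is the codensity monad of `F`. -/
def isoCodensityMonad (M : Monad C) (ε : F ⋙ M.toFunctor ⟶ F)
    [M.toFunctor.IsRightKanExtension ε]
    (hη : ∀ X, M.η.app (F.obj X) ≫ ε.app X = 𝟙 (F.obj X))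
    (hμ : ∀ X, M.μ.app (F.obj X) ≫ ε.app X = M.map (ε.app X) ≫ ε.app X) :
    M ≅ codensityMonad F := by
  -- The unit and multiplication squares for `e` are checked after composing with the counit, which
  -- determines maps into `ran F`.
  let e : M.toFunctor ≅ ran F := Functor.rightKanExtensionUnique _ ε _ (ranCounit F)
  have he : ∀ X, e.hom.app (F.obj X) ≫ (ranCounit F).app X = ε.app X := fun X => by
    simp [e, Functor.rightKanExtensionUnique]
  refine MonadIso.mk e (fun Y => ?_) (fun Y => ?_)
  · have : M.η ≫ e.hom = codensityUnit F := by
      apply (ran F).hom_ext_of_isRightKanExtension (ranCounit F)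
      ext X
      have h₁ := codensityUnit_fac F X
      simp only [Functor.id_obj] at h₁
      simp [he, hη, h₁]
    exact NatTrans.congr_app this Y
  · have : M.μ ≫ e.hom = (Functor.whiskerRight e.hom M.toFunctor ≫
        Functor.whiskerLeft (ran F) e.hom) ≫ codensityMul F := by
      apply (ran F).hom_ext_of_isRightKanExtension (ranCounit F)
      ext X
      have h₁ := codensityMul_fac F X
      simp only [Functor.comp_obj] at h₁
      simp only [NatTrans.comp_app, Functor.whiskerLeft_app, Functor.whiskerRight_app,
        Category.assoc, he, hμ, h₁, ← NatTrans.naturality_assoc]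
      rw [← Functor.map_comp_assoc, he]
    exact NatTrans.congr_app this Y

end Recognition

end Codensity

end

theorem mainTheorem9 :
    ∃ _ : Codensity.torusForget.{u}.HasPointwiseRightKanExtension Codensity.torusForget.{u},
      Nonempty (Codensity.doubleDualizationMonad.{u} ≅
        Codensity.codensityMonad Codensity.torusForget.{u}) := by
  have h := Codensity.doubleDualExtensionIsPointwise.{u}
  have hK : Codensity.doubleDualizationMonad.{u}.toFunctor.IsRightKanExtension
      Codensity.doubleDualCounit := h.isRightKanExtension
  exact ⟨fun X => (h X).hasPointwiseRightKanExtensionAt,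
    ⟨Codensity.isoCodensityMonad _ _ Codensity.doubleDualCounit (fun _ => rfl) (fun _ => rfl)⟩⟩
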